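/- A probability distribution $G$ on $\mathbb{R}$ is called zero-symmetric if it is invariant under $x\mapsto -x$; let $\mathcal{S}$ be the set of all such distributions. A distribution is called symmetric if it is a translate of a zero-symmetric one. Let $$\Omega_3=\Bigl\{(\boldsymbol\lambda,\boldsymbol\mu)\in\mathbb{R}^3\times\mathbb{R}^3:\ \lambda_j\ge 0,\ \textstyle\sum_j\lambda_j=1,\ \mu_1<\mu_2<\mu_3\Bigr\},\qquad \Delta_3(\boldsymbol\lambda,\boldsymbol\mu)=\sum_{j=1}^3\lambda_j\delta_{\mu_j},$$ where $\delta_t$ is the point mass at $t$. A distribution $F$ is called $3$-identifiable if there is exactly one triple $(\boldsymbol\lambda,\boldsymbol\mu,G)\in\Omega_3\times\mathcal{S}$ with $F=G\star\Delta_3(\boldsymbol\lambda,\boldsymbol\mu)$, where $\star$ denotes convolution. Let $\Omega_3^*$ be the set of all $(\boldsymbol\lambda,\boldsymbol\mu)\in\Omega_3$ such that $G\star\Delta_3(\boldsymbol\lambda,\boldsymbol\mu)$ is $3$-identifiable for every $G\in\mathcal{S}$. **Theorem.** Let $A$ be the set of all $(\boldsymbol\lambda,\boldsymbol\mu)\in\Omega_3$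 that satisfy, for some real numbers $c,d,r$ with $d>0$ and $r>1$, at least one of the four conditions 1. $\boldsymbol\mu=(c,\,c+4d,\,c+6d)$ and $\boldsymbol\lambda\propto(r^2,\,r^2-1,\,r)$; 2. $\boldsymbol\mu=(c+d,\,c+3d,\,c+5d)$ and $\boldsymbol\lambda\propto(r,\,r+1,\,1)$; 3. $\boldsymbol\mu=(c,\,c+3d,\,c+4d)$ and $\boldsymbol\lambda\propto(r\sqrt r,\,(r-1)\sqrt{r+1},\,\sqrt r)$; 4. $\boldsymbol\mu=(c+d,\,c+2d,\,c+3d)$ and $\boldsymbol\lambda\propto(r,\,\sqrt{r+r^2},\,1)$. Let $A^-$ be the set of all $(\boldsymbol\lambda,\boldsymbol\mu)\in\Omega_3$ such that $((\lambda_3,\lambda_2,\lambda_1),(-\mu_3,-\mu_2,-\mu_1))\in A$, and let $B$ be the set of all $(\boldsymbol\lambda,\boldsymbol\mu)\in\Omega_3$ such that $\Delta_3(\boldsymbol\lambda,\boldsymbol\mu)$ is symmetric or $\lambda_1\lambda_2\lambda_3=0$. Then $$\Omega_3^*=\Omega_3\setminus(A\cup A^-\cup B).$$ -/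

import Mathlib

open MeasureTheory

noncomputable section

namespace SymMixture

/-- A parameter `θ = (weights, locations)` of a `k`-component location mixture. -/
abbrev Param (k : ℕ) : Type := (Fin k → ℝ) × (Fin k → ℝ)

/-- The parameter space `Ω_k`: nonnegative weights with sum `1`, increasing locations. -/
def Omega (k : ℕ) : Set (Param k) :=
  {θ | (∀ j, 0 ≤ θ.1 j) ∧ ∑ j, θ.1 j = 1 ∧ StrictMono θ.2}

/-- The `k`-point distribution `Δ_k(θ)`, with mass `θ.1 j` at the point `θ.2 j`. -/
def Delta {k : ℕ} (θ : Param k) : Measure ℝ :=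
  ∑ j, ENNReal.ofReal (θ.1 j) • Measure.dirac (θ.2 j)

/-- The set `𝒮` of all probability distributions on `ℝ` that are symmetric about zero. -/
def ZeroSymmetric : Set (Measure ℝ) :=
  {G | IsProbabilityMeasure G ∧ G.map (fun x => -x) = G}

/-- A distribution is symmetric if it is a translate of a zero-symmetric one. -/
def IsSymmetric (F : Measure ℝ) : Prop :=
  ∃ G ∈ ZeroSymmetric, ∃ s : ℝ, F = G.map (fun x => x + s)

/-- The map `φ_k` that sends `(θ, G)` to the mixture `G ⋆ Δ_k(θ)`. -/
def mixture {k : ℕ} (x : Param k × Measure ℝ) : Measure ℝ :=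
  x.2.conv (Delta x.1)

/-- The set `ℳ_k` of all `k`-component mixtures, the image of `φ_k` on `Ω_k × 𝒮`. -/
def Mixtures (k : ℕ) : Set (Measure ℝ) :=
  mixture '' (Omega k ×ˢ ZeroSymmetric)

/-- The inverse image of `F` under `φ_k : Ω_k × 𝒮 → ℳ_k`. -/
def fiber (k : ℕ) (F : Measure ℝ) : Set (Param k × Measure ℝ) :=
  {x | x ∈ Omega k ×ˢ ZeroSymmetric ∧ mixture x = F}

/-- `F` is `k`-identifiable: it is a `k`-component mixture in exactly one way. -/
def IsIdentifiable (k : ℕ) (F : Measure ℝ) : Prop :=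
  F ∈ Mixtures k ∧ ∃ x, fiber k F = {x}

/-- `Ω_k^*`: the parameters whose mixtures are `k`-identifiable for every `G ∈ 𝒮`. -/
def OmegaStar (k : ℕ) : Set (Param k) :=
  {θ | θ ∈ Omega k ∧ ∀ G ∈ ZeroSymmetric, IsIdentifiable k (G.conv (Delta θ))}

/-- `v ∝ w`, with a positive constant of proportionality. -/
def Proportional (v w : Fin 3 → ℝ) : Prop :=
  ∃ s : ℝ, 0 < s ∧ v = s • w

/-- Gaps in ratio `2 : 1`. -/
def CaseOne (c d r : ℝ) (θ : Param 3) : Prop :=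
  θ.2 = ![c, c + 4 * d, c + 6 * d] ∧ Proportional θ.1 ![r ^ 2, r ^ 2 - 1, r]

/-- The companion of `CaseOne`, with equal gaps. -/
def CaseOne' (c d r : ℝ) (θ : Param 3) : Prop :=
  θ.2 = ![c + d, c + 3 * d, c + 5 * d] ∧ Proportional θ.1 ![r, r + 1, 1]

/-- Gaps in ratio `3 : 1`. -/
def CaseTwo (c d r : ℝ) (θ : Param 3) : Prop :=
  θ.2 = ![c, c + 3 * d, c + 4 * d] ∧
    Proportional θ.1 ![r * √r, (r - 1) * √(r + 1), √r]

/-- The companion of `CaseTwo`, with equal gaps. -/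
def CaseTwo' (c d r : ℝ) (θ : Param 3) : Prop :=
  θ.2 = ![c + d, c + 2 * d, c + 3 * d] ∧ Proportional θ.1 ![r, √(r + r ^ 2), 1]

/-- The exceptional set `A`. -/
def setA : Set (Param 3) :=
  {θ | θ ∈ Omega 3 ∧ ∃ c d r : ℝ, 0 < d ∧ 1 < r ∧
    (CaseOne c d r θ ∨ CaseOne' c d r θ ∨ CaseTwo c d r θ ∨ CaseTwo' c d r θ)}

/-- The reflected set `A⁻`. -/
def setAneg : Set (Param 3) :=
  {θ | θ ∈ Omega 3 ∧
    ((![θ.1 2, θ.1 1, θ.1 0], ![-θ.2 2, -θ.2 1, -θ.2 0]) : Param 3) ∈ setA}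

/-- The set `B`: the three-point distribution is symmetric or some weight vanishes. -/
def setB : Set (Param 3) :=
  {θ | θ ∈ Omega 3 ∧ (IsSymmetric (Delta θ) ∨ θ.1 0 * θ.1 1 * θ.1 2 = 0)}

end SymMixture

end

/-!
Call two distributions companions if the difference of independent draws from them is symmetric
about zero. If `G ⋆ Δ(θ) = G' ⋆ Δ(θ')` with `G` and `G'` zero-symmetric, then dividing by the
characteristic functions of `G` and `G'`, which are real and nonzero near `0`, shows that `Δ(θ)` and
`Δ(θ')` are companions; conversely, companions have a common mixture. Hence `θ` lies in `Ω_k^*` if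
and only if `Δ(θ)` has no companion `Δ(θ')` with `θ' ≠ θ`.

For three-point distributions the difference has nine atoms, which symmetry must pair off. The two
extreme ones force equal midpoints and equal ratios of end weights. After a reflection the left end
is at least as heavy as the right one, and comparing the remaining atoms leaves only symmetric
distributions and the pairs of companions that make up `A`.
-/

namespace SymMixture

open ProbabilityTheory Set Filter Topology
open scoped ComplexConjugate

section CharFun

variable {μ ν G G' : Measure ℝ}

lemma charFun_map_neg (μ : Measure ℝ) (t : ℝ) :
    charFun (μ.map fun x => -x) t = conj (charFun μ t) := by
  simpa [charFun_neg] using charFun_map_mul (μ := μ) (-1) t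

lemma mem_zeroSymmetric_iff_im_charFun :
    G ∈ ZeroSymmetric ↔ IsProbabilityMeasure G ∧ ∀ t, (charFun G t).im = 0 := by
  refine and_congr_right fun _ => ⟨fun h t => ?_, fun h => ?_⟩
  · rw [← Complex.conj_eq_iff_im, ← charFun_map_neg, h]
  · exact Measure.ext_of_charFun (funext fun t => by
      rw [charFun_map_neg, Complex.conj_eq_iff_im, h])

lemma analyticOnNhd_charFun (h : integrableExpSet id μ = univ) :
    AnalyticOnNhd ℝ (charFun μ) univ := by
  intro t _
  have hmgf : AnalyticAt ℝ (complexMGF id μ) (t * Complex.I) :=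
    (analyticAt_complexMGF (by simp [h])).restrictScalars
  have hline : AnalyticAt ℝ (fun t : ℝ => (t : ℂ) * Complex.I) t :=
    (Complex.ofRealCLM.analyticAt t).mul analyticAt_const
  simpa only [Function.comp_def, complexMGF_id_mul_I] using hmgf.comp_of_eq hline rfl

lemma dense_charFun_ne_zero [IsProbabilityMeasure μ] (h : integrableExpSet id μ = univ) :
    Dense {t | charFun μ t ≠ 0} := by
  refine dense_iff_inter_open.2 fun U hU ⟨t, ht⟩ => ?_
  by_contra hempty
  have hzero : ∀ᶠ s in 𝓝 t, charFun μ s = 0 := by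
    filter_upwards [hU.mem_nhds ht] with s hs
    by_contra hne
    exact hempty ⟨s, hs, hne⟩
  have := (analyticOnNhd_charFun h).eqOn_zero_of_preconnected_of_eventuallyEq_zero
    isPreconnected_univ (mem_univ t) hzero (mem_univ 0)
  simp at this

lemma conv_right_cancel [IsProbabilityMeasure μ] [IsFiniteMeasure G] [IsFiniteMeasure G']
    (hμ : integrableExpSet id μ = univ) (h : G.conv μ = G'.conv μ) : G = G' := by
  refine Measure.ext_of_charFun
    (continuous_charFun.ext_on (dense_charFun_ne_zero hμ) continuous_charFun fun t ht => ?_)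
  refine mul_right_cancel₀ ht ?_
  rw [← charFun_conv, ← charFun_conv, h]

end CharFun

section Companion

variable {μ ν G G' : Measure ℝ}

/-- `μ` and `ν` are companions if the difference of independent draws from `μ` and `ν` is symmetric
about zero. -/
def Companion (μ ν : Measure ℝ) : Prop :=
  μ.conv (ν.map fun x => -x) ∈ ZeroSymmetric

instance isProbabilityMeasure_map_neg [IsProbabilityMeasure μ] :
    IsProbabilityMeasure (μ.map fun x => -x) :=
  Measure.isProbabilityMeasure_map measurable_neg.aemeasurable

variable [IsProbabilityMeasure μ] [IsProbabilityMeasure ν]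

lemma companion_iff_im_charFun :
    Companion μ ν ↔ ∀ t, (charFun μ t * conj (charFun ν t)).im = 0 := by
  have hprob : IsProbabilityMeasure (μ.conv (ν.map fun x => -x)) := inferInstance
  simp only [Companion, mem_zeroSymmetric_iff_im_charFun, hprob, true_and, charFun_conv,
    charFun_map_neg]

lemma Companion.refl (μ : Measure ℝ) [IsProbabilityMeasure μ] : Companion μ μ :=
  companion_iff_im_charFun.2 fun t => by rw [Complex.mul_conj, Complex.ofReal_im]

lemma Companion.symm (h : Companion μ ν) : Companion ν μ := by
  rw [companion_iff_im_charFun] at h ⊢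
  intro t
  rw [← neg_eq_zero, ← Complex.conj_im, map_mul, Complex.conj_conj, mul_comm, h]

lemma Companion.map_neg (h : Companion μ ν) :
    Companion (μ.map fun x => -x) (ν.map fun x => -x) := by
  rw [companion_iff_im_charFun] at h ⊢
  intro t
  rw [charFun_map_neg, charFun_map_neg, ← map_mul, Complex.conj_im, h, neg_zero]

/- Where the characteristic function of `G` does not vanish, in particular near `0`, it is a real
factor that can be cancelled; analyticity then spreads the conclusion over the whole line. -/
lemma companion_of_conv_eq (hμ : integrableExpSet id μ = univ)
    (hν : integrableExpSet id ν = univ) (hG : G ∈ ZeroSymmetric) (hG' : G' ∈ ZeroSymmetric)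
    (h : G.conv μ = G'.conv ν) : Companion μ ν := by
  obtain ⟨_, hreal⟩ := mem_zeroSymmetric_iff_im_charFun.1 hG
  obtain ⟨_, hreal'⟩ := mem_zeroSymmetric_iff_im_charFun.1 hG'
  have hprod (t : ℝ) : charFun G t * charFun μ t = charFun G' t * charFun ν t := by
    rw [← charFun_conv, ← charFun_conv, h]
  have hnear : ∀ᶠ t in 𝓝 (0 : ℝ), charFun G t ≠ 0 :=
    continuous_charFun.continuousAt.eventually_ne (by simp)
  have hzero : ∀ᶠ t in 𝓝 (0 : ℝ), (charFun μ t * conj (charFun ν t)).im = 0 := by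
    filter_upwards [hnear] with t ht
    have him : (charFun G t * (charFun μ t * conj (charFun ν t))).im = 0 := by
      rw [← mul_assoc, hprod, mul_assoc, Complex.mul_conj, Complex.im_mul_ofReal, hreal' t,
        zero_mul]
    rw [Complex.mul_im, hreal t, zero_mul, add_zero] at him
    exact (mul_eq_zero.1 him).resolve_left fun hre => ht (Complex.ext hre (hreal t))
  have hanalytic : AnalyticOnNhd ℝ (fun t => (charFun μ t * conj (charFun ν t)).im) univ :=
    fun t ht => (Complex.imCLM.analyticAt _).comp ((analyticOnNhd_charFun hμ t ht).mul
      ((Complex.conjCLE.analyticAt _).comp (analyticOnNhd_charFun hν t ht)))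
  exact companion_iff_im_charFun.2 fun t =>
    hanalytic.eqOn_zero_of_preconnected_of_eventuallyEq_zero isPreconnected_univ (mem_univ 0)
      hzero (mem_univ t)

lemma isSymmetric_iff_exists_companion_dirac :
    IsSymmetric μ ↔ ∃ s, Companion μ (Measure.dirac s) := by
  have hshift (s : ℝ) : μ.conv ((Measure.dirac s).map fun x => -x) = μ.map (fun x => x + -s) := by
    rw [Measure.map_dirac' measurable_neg, Measure.conv_dirac]
  have hinv (s : ℝ) (G : Measure ℝ) : (G.map (fun x => x + s)).map (fun x => x + -s) = G := by
    rw [Measure.map_map (by fun_prop) (by fun_prop)]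
    simp [Function.comp_def]
  simp only [Companion, hshift]
  constructor
  · rintro ⟨G, hG, s, rfl⟩
    exact ⟨s, by rwa [hinv]⟩
  · rintro ⟨s, hs⟩
    exact ⟨_, hs, s, by simpa using (hinv (-s) μ).symm⟩

lemma IsSymmetric.map_neg (h : IsSymmetric μ) : IsSymmetric (μ.map fun x => -x) := by
  obtain ⟨s, hs⟩ := isSymmetric_iff_exists_companion_dirac.1 h
  refine isSymmetric_iff_exists_companion_dirac.2 ⟨-s, ?_⟩
  simpa only [Measure.map_dirac' measurable_neg] using hs.map_neg

end Companion

section Atoms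

variable {ι κ : Type*} [Fintype ι] [Fintype κ] {w x : ι → ℝ} {v y : κ → ℝ}

/-- The finite measure with mass `w j` at the point `x j`, the common form of `Delta θ` and of the
difference of two such distributions. Negative weights are truncated to zero. -/
noncomputable def atoms (w x : ι → ℝ) : Measure ℝ :=
  ∑ j, ENNReal.ofReal (w j) • Measure.dirac (x j)

instance isFiniteMeasure_atoms (w x : ι → ℝ) : IsFiniteMeasure (atoms w x) := by
  constructor
  simp [atoms, Measure.finsetSum_apply]

lemma isProbabilityMeasure_atoms (hw : ∀ j, 0 ≤ w j) (hsum : ∑ j, w j = 1) (x : ι → ℝ) :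
    IsProbabilityMeasure (atoms w x) := by
  constructor
  simp [atoms, Measure.finsetSum_apply, ← ENNReal.ofReal_sum_of_nonneg fun j _ => hw j, hsum]

lemma integrable_atoms (w x : ι → ℝ) (f : ℝ → ℝ) : Integrable f (atoms w x) :=
  integrable_finsetSum_measure.2 fun _ _ => (integrable_dirac (by simp)).smul_measure (by simp)

lemma integrableExpSet_atoms (w x : ι → ℝ) : integrableExpSet id (atoms w x) = univ :=
  eq_univ_of_forall fun _ => integrable_atoms w x _

lemma integral_atoms (hw : ∀ j, 0 ≤ w j) (x : ι → ℝ) (f : ℝ → ℝ) :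
    ∫ z, f z ∂atoms w x = ∑ j, w j * f (x j) := by
  rw [atoms, integral_finsetSum_measure fun j _ =>
    (integrable_dirac (by simp)).smul_measure (by simp)]
  simp [integral_smul_measure, hw]

lemma map_neg_atoms (w x : ι → ℝ) : (atoms w x).map (fun z => -z) = atoms w (-x) := by
  rw [atoms, Measure.map_finset_sum' measurable_neg.aemeasurable]
  simp [atoms, Measure.map_smul, Measure.map_dirac' measurable_neg]

lemma atoms_conv_atoms (hw : ∀ i, 0 ≤ w i) (x : ι → ℝ) (v y : κ → ℝ) :
    (atoms w x).conv (atoms v y) =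
      atoms (fun p : ι × κ => w p.1 * v p.2) (fun p => x p.1 + y p.2) := by
  refine Measure.ext_of_lintegral _ fun f hf => ?_
  rw [Measure.lintegral_conv hf]
  simp [atoms, lintegral_finsetSum_measure, Fintype.sum_prod_type, Finset.mul_sum, mul_assoc,
    ENNReal.ofReal_mul, hw]

lemma atoms_mem_zeroSymmetric_iff (hw : ∀ j, 0 ≤ w j) (hsum : ∑ j, w j = 1) :
    atoms w x ∈ ZeroSymmetric ↔ ∀ f : ℝ → ℝ, f.Odd → ∑ j, w j * f (x j) = 0 := by
  have hprob := isProbabilityMeasure_atoms hw hsum x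
  constructor
  · rintro ⟨-, h⟩ f hf
    have hneg : ∫ z, f z ∂atoms w x = -∫ z, f z ∂atoms w x := by
      conv_lhs => rw [← h]
      rw [← integral_neg]
      simpa [hf _] using integral_map_equiv (μ := atoms w x) (MeasurableEquiv.neg ℝ) f
    rw [← integral_atoms hw]
    linarith
  · refine fun h => ⟨hprob, ?_⟩
    ext S hS
    have hreal : (atoms w x).real S - (atoms w x).real ((fun z => -z) ⁻¹' S) = 0 := by
      rw [← integral_indicator_one hS, ← integral_indicator_one (measurable_neg hS),
        ← integral_sub (integrable_atoms _ _ _) (integrable_atoms _ _ _), integral_atoms hw]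
      exact h (fun z => S.indicator 1 z - S.indicator 1 (-z)) fun z => by simp
    rw [Measure.map_apply measurable_neg hS, ← measureReal_eq_measureReal_iff]
    linarith

end Atoms

section Delta

variable {k : ℕ} {θ θ' : Param k}

lemma isProbabilityMeasure_Delta (hθ : θ ∈ Omega k) : IsProbabilityMeasure (Delta θ) :=
  isProbabilityMeasure_atoms hθ.1 hθ.2.1 θ.2

lemma companion_Delta_iff {l : ℕ} {η : Param l} (hθ : θ ∈ Omega k) (hη : η ∈ Omega l) :
    Companion (Delta θ) (Delta η) ↔ ∀ f : ℝ → ℝ, f.Odd →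
      ∑ i, ∑ j, θ.1 i * η.1 j * f (θ.2 i - η.2 j) = 0 := by
  have hconv : (Delta θ).conv ((Delta η).map fun x => -x) =
      atoms (fun p : Fin k × Fin l => θ.1 p.1 * η.1 p.2) (fun p => θ.2 p.1 - η.2 p.2) := by
    simp only [sub_eq_add_neg]
    exact (congrArg _ (map_neg_atoms η.1 η.2)).trans (atoms_conv_atoms hθ.1 θ.2 η.1 _)
  rw [Companion, hconv, atoms_mem_zeroSymmetric_iff (fun p => mul_nonneg (hθ.1 _) (hη.1 _))]
  · simp only [Fintype.sum_prod_type]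
  · rw [Fintype.sum_prod_type, ← Fintype.sum_mul_sum, hθ.2.1, hη.2.1, one_mul]

lemma isSymmetric_Delta_iff (hθ : θ ∈ Omega k) :
    IsSymmetric (Delta θ) ↔ ∃ s, ∀ f : ℝ → ℝ, f.Odd → ∑ i, θ.1 i * f (θ.2 i - s) = 0 := by
  have := isProbabilityMeasure_Delta hθ
  rw [isSymmetric_iff_exists_companion_dirac]
  refine exists_congr fun s => ?_
  have hpoint : ((fun _ => 1, fun _ => s) : Param 1) ∈ Omega 1 :=
    ⟨fun _ => zero_le_one, by simp, Subsingleton.strictMono _⟩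
  simpa [Delta] using companion_Delta_iff hθ hpoint

/- If `θ` and `θ'` are companions, then `Δ(θ) ⋆ Δ(θ')⁻ ⋆ Δ(θ')` has two representations, with
`G = Δ(θ') ⋆ Δ(θ')⁻` and with `G' = Δ(θ) ⋆ Δ(θ')⁻`. -/
lemma mem_OmegaStar_iff :
    θ ∈ OmegaStar k ↔
      θ ∈ Omega k ∧ ∀ θ' ∈ Omega k, Companion (Delta θ) (Delta θ') → θ' = θ := by
  refine and_congr_right fun hθ => ⟨fun h θ' hθ' hc => ?_, fun h G hG => ?_⟩
  · have := isProbabilityMeasure_Delta hθ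
    have := isProbabilityMeasure_Delta hθ'
    set N := (Delta θ').map fun x => -x
    obtain ⟨-, x, hx⟩ := h _ (Companion.refl (Delta θ'))
    have hmem : (θ, (Delta θ').conv N) ∈ ({x} : Set _) :=
      hx ▸ ⟨⟨hθ, Companion.refl (Delta θ')⟩, rfl⟩
    have hmem' : (θ', (Delta θ).conv N) ∈ ({x} : Set _) := by
      refine hx ▸ ⟨⟨hθ', hc⟩, ?_⟩
      rw [mixture, Measure.conv_assoc, Measure.conv_comm N, Measure.conv_comm]
    exact congrArg Prod.fst (hmem'.trans hmem.symm)
  · refine ⟨⟨(θ, G), ⟨hθ, hG⟩, rfl⟩, (θ, G), eq_singleton_iff_unique_mem.2 ⟨⟨⟨hθ, hG⟩, rfl⟩, ?_⟩⟩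
    rintro ⟨θ', G'⟩ ⟨⟨hθ', hG'⟩, heq : G'.conv (Delta θ') = G.conv (Delta θ)⟩
    have := isProbabilityMeasure_Delta hθ
    have := isProbabilityMeasure_Delta hθ'
    have := hG.1
    have := hG'.1
    obtain rfl := h θ' hθ' (companion_of_conv_eq (integrableExpSet_atoms _ _)
      (integrableExpSet_atoms _ _) hG hG' heq.symm)
    rw [conv_right_cancel (μ := Delta θ') (integrableExpSet_atoms _ _) heq]

end Delta

section Ends

/-- The odd test function that reads off the mass at `x` minus the mass at `-x`. -/
noncomputable def oddIndicator (x y : ℝ) : ℝ :=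
  (if y = x then 1 else 0) - (if y = -x then 1 else 0)

lemma odd_oddIndicator (x : ℝ) : (oddIndicator x).Odd := fun y => by
  simp only [oddIndicator, neg_eq_iff_eq_neg, neg_neg, neg_sub]

lemma oddIndicator_self {x : ℝ} (hx : x ≠ 0) : oddIndicator x x = 1 := by
  simp [oddIndicator, self_eq_neg, hx]

lemma oddIndicator_nonneg {x y : ℝ} (h : y ≠ -x) : 0 ≤ oddIndicator x y := by
  rw [oddIndicator, if_neg h]
  split_ifs <;> simp

lemma oddIndicator_nonpos {x y : ℝ} (h : y ≠ x) : oddIndicator x y ≤ 0 := by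
  rw [oddIndicator, if_neg h]
  split_ifs <;> simp

lemma oddIndicator_eq_zero {x y : ℝ} (h : y ≠ x) (h' : y ≠ -x) : oddIndicator x y = 0 := by
  rw [oddIndicator, if_neg h, if_neg h', sub_zero]

variable {k : ℕ} {θ θ' : Param (k + 2)}

lemma sub_lt_last_sub_zero (hθ : StrictMono θ.2) (hθ' : StrictMono θ'.2) {i j : Fin (k + 2)}
    (hij : (i, j) ≠ (Fin.last _, 0)) : θ.2 i - θ'.2 j < θ.2 (Fin.last _) - θ'.2 0 := by
  have hi := hθ.monotone (Fin.le_last i)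
  have hj := hθ'.monotone (Fin.zero_le j)
  rcases (Fin.le_last i).lt_or_eq with h | rfl
  · linarith [hθ h]
  · have hj0 : j ≠ 0 := by rintro rfl; exact hij rfl
    linarith [hθ' (Fin.pos_of_ne_zero hj0)]

/- Otherwise the largest difference of locations exceeds the smallest one in absolute value, so
that its mass has no counterpart. -/
lemma Companion.zero_add_last_le (hθ : θ ∈ Omega (k + 2)) (hθ' : θ' ∈ Omega (k + 2))
    (hlast : 0 < θ.1 (Fin.last _)) (hzero' : 0 < θ'.1 0) (h : Companion (Delta θ) (Delta θ')) :
    θ.2 0 + θ.2 (Fin.last _) ≤ θ'.2 0 + θ'.2 (Fin.last _) := by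
  by_contra! hlt
  set M := θ.2 (Fin.last _) - θ'.2 0
  have hmin (i j) : -M < θ.2 i - θ'.2 j := by
    linarith [hθ.2.2.monotone (Fin.zero_le i), hθ'.2.2.monotone (Fin.le_last j)]
  have hM : M ≠ 0 := fun h0 => by
    linarith only [h0, show -M < M from hmin (Fin.last _) 0]
  have hnonneg (i j) : 0 ≤ θ.1 i * θ'.1 j * oddIndicator M (θ.2 i - θ'.2 j) :=
    mul_nonneg (mul_nonneg (hθ.1 i) (hθ'.1 j)) (oddIndicator_nonneg (hmin i j).ne')
  have hpos : 0 < θ.1 (Fin.last _) * θ'.1 0 * oddIndicator M M :=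
    mul_pos (mul_pos hlast hzero') (by simp [oddIndicator_self hM])
  refine (Finset.sum_pos' (fun i _ => Finset.sum_nonneg fun j _ => hnonneg i j)
    ⟨Fin.last _, Finset.mem_univ _, Finset.sum_pos' (fun j _ => hnonneg _ j)
      ⟨0, Finset.mem_univ _, hpos⟩⟩).ne' ?_
  exact (companion_Delta_iff hθ hθ').1 h _ (odd_oddIndicator M)

lemma Companion.zero_add_last_eq (hθ : θ ∈ Omega (k + 2)) (hθ' : θ' ∈ Omega (k + 2))
    (hzero : 0 < θ.1 0) (hlast : 0 < θ.1 (Fin.last _)) (hzero' : 0 < θ'.1 0)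
    (hlast' : 0 < θ'.1 (Fin.last _)) (h : Companion (Delta θ) (Delta θ')) :
    θ.2 0 + θ.2 (Fin.last _) = θ'.2 0 + θ'.2 (Fin.last _) :=
  have := isProbabilityMeasure_Delta hθ
  have := isProbabilityMeasure_Delta hθ'
  le_antisymm (h.zero_add_last_le hθ hθ' hlast hzero')
    (h.symm.zero_add_last_le hθ' hθ hlast' hzero)

lemma Companion.last_mul_zero_eq (hθ : θ ∈ Omega (k + 2)) (hθ' : θ' ∈ Omega (k + 2))
    (hends : θ.2 0 + θ.2 (Fin.last _) = θ'.2 0 + θ'.2 (Fin.last _))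
    (h : Companion (Delta θ) (Delta θ')) :
    θ.1 (Fin.last _) * θ'.1 0 = θ.1 0 * θ'.1 (Fin.last _) := by
  set M := θ.2 (Fin.last _) - θ'.2 0 with hM
  have hmin : θ.2 0 - θ'.2 (Fin.last _) = -M := by linarith
  have hM0 : 0 < M := by linarith [hθ.2.2 Fin.last_pos, hθ'.2.2 Fin.last_pos]
  have hmass := (companion_Delta_iff hθ hθ').1 h _ (odd_oddIndicator M)
  rw [← Fintype.sum_prod_type', Fintype.sum_eq_add (Fin.last _, 0) (0, Fin.last _) (by simp)]
    at hmass
  · simp only [← hM, hmin, odd_oddIndicator M M, oddIndicator_self hM0.ne'] at hmass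
    linarith
  · rintro ⟨i, j⟩ ⟨hne, hne'⟩
    have hlt := sub_lt_last_sub_zero hθ.2.2 hθ'.2.2 hne
    have hgt := sub_lt_last_sub_zero hθ'.2.2 hθ.2.2 (i := j) (j := i) (by grind)
    rw [oddIndicator_eq_zero hlt.ne (by linarith), mul_zero]

end Ends

section Balanced

variable {A B m n ρ p q : ℝ}

/-- The distributions with weights proportional to `(ρ, p, 1)` at `(-A, m, A)` and to `(ρ, q, 1)` at
`(-B, n, B)` are companions: the difference of independent draws integrates every odd function to
zero. The two terms with value `f (A + B)` cancel, and the others are arranged so that the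
coefficients are nonnegative for `1 ≤ ρ`. -/
def Balanced (A B m n ρ p q : ℝ) : Prop :=
  ∀ f : ℝ → ℝ, f.Odd →
    q * f (A - n) + p * ρ * f (B + m) + p * q * f (m - n) =
      (ρ ^ 2 - 1) * f (A - B) + q * ρ * f (A + n) + p * f (B - m)

lemma Balanced.swap (h : Balanced A B m n ρ p q) : Balanced B A n m ρ q p := by
  intro f hf
  have hAB := hf (A - B)
  have hmn := hf (m - n)
  rw [neg_sub] at hAB hmn
  rw [hAB, hmn]
  linarith [h f hf]

/- The mass at `A - n` can only be balanced if `m < n`, and then the mass at `A + n` cannot. -/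
lemma Balanced.middle_eq_zero_of_lt (h : Balanced A B m n ρ p q) (hBA : B < A) (hm : |m| < A)
    (hn : |n| < B) (hρ : 0 < ρ) (hp : 0 ≤ p) (hq : 0 < q) : n = 0 := by
  rw [abs_lt] at hm hn
  by_contra hn0
  have hlt : m < n := by
    by_contra! hnm
    have htest := h _ (odd_oddIndicator (A - n))
    have hBpm : 0 ≤ oddIndicator (A - n) (B + m) := oddIndicator_nonneg (by grind)
    have hmn : 0 ≤ oddIndicator (A - n) (m - n) := oddIndicator_nonneg (by grind)
    have hBm : oddIndicator (A - n) (B - m) ≤ 0 := oddIndicator_nonpos (by grind)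
    rw [oddIndicator_self (by grind), oddIndicator_eq_zero (y := A - B) (by grind) (by grind),
      oddIndicator_eq_zero (y := A + n) (by grind) (by grind)] at htest
    linarith [mul_nonneg (mul_nonneg hp hρ.le) hBpm, mul_nonneg (mul_nonneg hp hq.le) hmn,
      mul_nonpos_of_nonneg_of_nonpos hp hBm]
  have htest := h _ (odd_oddIndicator (A + n))
  have hBpm : oddIndicator (A + n) (B + m) ≤ 0 := oddIndicator_nonpos (by grind)
  have hmn : oddIndicator (A + n) (m - n) ≤ 0 := oddIndicator_nonpos (by grind)
  have hBm : 0 ≤ oddIndicator (A + n) (B - m) := oddIndicator_nonneg (by grind)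
  rw [oddIndicator_self (by grind), oddIndicator_eq_zero (y := A - B) (by grind) (by grind),
    oddIndicator_eq_zero (y := A - n) (by grind) (by grind)] at htest
  linarith [mul_pos hq hρ, mul_nonpos_of_nonneg_of_nonpos (mul_nonneg hp hρ.le) hBpm,
    mul_nonpos_of_nonneg_of_nonpos (mul_nonneg hp hq.le) hmn, mul_nonneg hp hBm]

lemma Balanced.middle_eq_sub_of_lt (h : Balanced A B m 0 ρ p q) (hB : 0 < B) (hBA : B < A)
    (hm : |m| < A) (hρ : 1 < ρ) (hp : 0 < p) (hq : 0 < q) :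
    m = A - B ∧ p * ρ = q * (ρ - 1) := by
  rw [abs_lt] at hm
  have htest := h _ (odd_oddIndicator A)
  simp only [sub_zero, add_zero] at htest
  rw [oddIndicator_self (by grind), oddIndicator_eq_zero (y := m) (by grind) (by grind),
    oddIndicator_eq_zero (y := A - B) (by grind) (by grind)] at htest
  have hmA : m = A - B := by
    by_contra hne
    have hBpm : oddIndicator A (B + m) ≤ 0 := oddIndicator_nonpos (by grind)
    have hBm : 0 ≤ oddIndicator A (B - m) := oddIndicator_nonneg (by grind)
    linarith [mul_nonneg hp.le hBm, mul_pos hq (sub_pos.2 hρ),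
      mul_nonpos_of_nonneg_of_nonpos (mul_pos hp (one_pos.trans hρ)).le hBpm]
  rw [show B + m = A by linarith, oddIndicator_self (by grind),
    oddIndicator_eq_zero (y := B - m) (by grind) (by grind)] at htest
  exact ⟨hmA, by linarith⟩

/-- The companions behind the exceptional set `A`: weights proportional to `(ρ, p, 1)` at
`(-A, m, A)`, and weights proportional to `(ρ, q, 1)` at the equally spaced points `(-B, 0, B)`.
The two alternatives are conditions 1, 2 and conditions 3, 4, with `d = m` and `r = ρ`. -/
def ExceptionalPair (A m B ρ p q : ℝ) : Prop :=
  0 < m ∧ 1 < ρ ∧ p = (ρ - 1) * q / ρ ∧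
    (A = 3 * m ∧ B = 2 * m ∧ q = ρ + 1 ∨ A = 2 * m ∧ B = m ∧ q = √(ρ + ρ ^ 2))

lemma Balanced.exceptionalPair_of_lt (h : Balanced A B m 0 ρ p q) (hB : 0 < B) (hBA : B < A)
    (hm : |m| < A) (hρ : 1 < ρ) (hp : 0 < p) (hq : 0 < q) : ExceptionalPair A m B ρ p q := by
  obtain ⟨hmA, hweight⟩ := h.middle_eq_sub_of_lt hB hBA hm hρ hp hq
  have hrest (f : ℝ → ℝ) (hf : f.Odd) :
      (p * q - (ρ ^ 2 - 1)) * f m = p * f (B - m) := by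
    have := h f hf
    rw [show B + m = A by linarith, ← hmA, hweight, sub_zero, sub_zero, add_zero] at this
    linarith
  have hp_eq : p = (ρ - 1) * q / ρ := by
    field_simp
    linarith
  refine ⟨by linarith, hρ, hp_eq, ?_⟩
  have htest := hrest _ (odd_oddIndicator m)
  rw [oddIndicator_self (by linarith)] at htest
  by_cases hBm : B - m = m
  · have hfactor : (ρ - 1) * (q + ρ) * (q - (ρ + 1)) = 0 := by
      rw [hBm, oddIndicator_self (by linarith), hp_eq] at htest
      field_simp at htest
      linarith
    have hne : (ρ - 1) * (q + ρ) ≠ 0 := (mul_pos (by linarith) (by linarith)).ne'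
    exact .inl ⟨by linarith, by linarith, by linarith [(mul_eq_zero.1 hfactor).resolve_left hne]⟩
  · have hfactor : (ρ - 1) * (q * q - (ρ + ρ ^ 2)) = 0 := by
      rw [oddIndicator_eq_zero (y := B - m) hBm (by grind), hp_eq] at htest
      field_simp at htest
      linarith
    have hsq : q * q = ρ + ρ ^ 2 := by
      linarith [(mul_eq_zero.1 hfactor).resolve_left (by linarith)]
    have hBm0 : B - m = 0 := by
      by_contra hne
      have htest' := hrest _ (odd_oddIndicator (B - m))
      rw [oddIndicator_self hne, oddIndicator_eq_zero (y := m) (by grind) (by grind)] at htest'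
      linarith
    exact .inr ⟨by linarith, by linarith, ((Real.sqrt_eq_iff_mul_self_eq_of_pos hq).2 hsq).symm⟩

lemma ExceptionalPair.balanced (h : ExceptionalPair A m B ρ p q) : Balanced A B m 0 ρ p q := by
  obtain ⟨-, hρ, rfl, ⟨rfl, rfl, rfl⟩ | ⟨rfl, rfl, hq⟩⟩ := h <;> intro f hf
  · rw [sub_zero, sub_zero, add_zero, show 2 * m + m = 3 * m by ring,
      show 3 * m - 2 * m = m by ring, show 2 * m - m = m by ring]
    field_simp
    ring
  · have hsq : q ^ 2 = ρ + ρ ^ 2 := by rw [hq, Real.sq_sqrt (by positivity)]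
    rw [sub_zero, sub_zero, add_zero, sub_self, hf.map_zero, ← two_mul,
      show 2 * B - B = B by ring]
    field_simp
    linear_combination (ρ - 1) * f B * hsq

lemma Balanced.middle_eq_zero_of_eq_one (h : Balanced A B m 0 1 p q) (hp : 0 < p) (hq : 0 ≤ q) :
    m = 0 := by
  have hmean : p * (2 + q) * m = 0 := by
    have := h id fun _ => rfl
    simp only [id_eq] at this
    linarith
  exact (mul_eq_zero.1 hmean).resolve_left (by positivity)

lemma Balanced.middle_le_middle (h : Balanced A A m n ρ p q) (hm : |m| < A) (hn : |n| < A)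
    (hρ : 0 < ρ) (hp : 0 < p) (hq : 0 < q) : m ≤ n := by
  rw [abs_lt] at hm hn
  by_contra! hlt
  have hpρ : 0 < p * ρ := by positivity
  have hpq : 0 < p * q := by positivity
  by_cases hm0 : m = 0
  · have htest := h _ (odd_oddIndicator (A - n))
    have hApm : 0 ≤ oddIndicator (A - n) (A + m) := oddIndicator_nonneg (by grind)
    have hmn : 0 ≤ oddIndicator (A - n) (m - n) := oddIndicator_nonneg (by grind)
    rw [oddIndicator_self (by grind), oddIndicator_eq_zero (y := A - A) (by grind) (by grind),
      oddIndicator_eq_zero (y := A + n) (by grind) (by grind),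
      oddIndicator_eq_zero (y := A - m) (by grind) (by grind)] at htest
    linarith [mul_nonneg hpρ.le hApm, mul_nonneg hpq.le hmn]
  · have htest := h _ (odd_oddIndicator (A + m))
    have hAn : 0 ≤ oddIndicator (A + m) (A - n) := oddIndicator_nonneg (by grind)
    have hmn : 0 ≤ oddIndicator (A + m) (m - n) := oddIndicator_nonneg (by grind)
    rw [oddIndicator_self (by grind), oddIndicator_eq_zero (y := A - A) (by grind) (by grind),
      oddIndicator_eq_zero (y := A + n) (by grind) (by grind),
      oddIndicator_eq_zero (y := A - m) (by grind) (by grind)] at htest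
    linarith [mul_nonneg hq.le hAn, mul_nonneg hpq.le hmn]

lemma Balanced.eq_or_centered (h : Balanced A A m n ρ p q) (hm : |m| < A) (hn : |n| < A)
    (hρ : 0 < ρ) (hp : 0 < p) (hq : 0 < q) : m = n ∧ (p = q ∨ m = 0 ∧ ρ = 1) := by
  obtain rfl : m = n := le_antisymm (h.middle_le_middle hm hn hρ hp hq)
    (h.swap.middle_le_middle hn hm hρ hq hp)
  rw [abs_lt] at hm
  refine ⟨rfl, or_iff_not_imp_left.2 fun hpq => ?_⟩
  have hrest (f : ℝ → ℝ) (hf : f.Odd) : f (A - m) = ρ * f (A + m) := by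
    have := h f hf
    rw [sub_self, sub_self, hf.map_zero] at this
    exact mul_left_cancel₀ (sub_ne_zero.2 hpq) (by linarith)
  have hm0 : m = 0 := by
    by_contra hm0
    have htest := hrest _ (odd_oddIndicator (A - m))
    rw [oddIndicator_self (by grind), oddIndicator_eq_zero (by grind) (by grind)] at htest
    linarith
  have htest := hrest _ (odd_oddIndicator A)
  rw [hm0, sub_zero, add_zero, oddIndicator_self (by grind)] at htest
  exact ⟨hm0, by linarith⟩

/-- The distribution with weights proportional to `(ρ, p, 1)` at `(-A, m, A)` belongs to an
exceptional pair. -/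
def Exceptional (A m ρ p : ℝ) : Prop :=
  (∃ B q, ExceptionalPair A m B ρ p q) ∨ m = 0 ∧ ∃ B n q, ExceptionalPair B n A ρ q p

lemma Balanced.middle_nonneg (h : Balanced A B m n ρ p 0) (hB : 0 < B) (hmA : m < A)
    (hρ : 1 ≤ ρ) (hp : 0 < p) : 0 ≤ m := by
  by_contra! hm
  have htest := h _ (odd_oddIndicator (B - m))
  have hBpm : oddIndicator (B - m) (B + m) ≤ 0 := oddIndicator_nonpos (by grind)
  have hAB : 0 ≤ oddIndicator (B - m) (A - B) := oddIndicator_nonneg (by grind)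
  rw [oddIndicator_self (by grind)] at htest
  have hρ2 : 0 ≤ ρ ^ 2 - 1 := by nlinarith
  linarith [mul_nonneg hρ2 hAB, mul_nonpos_of_nonneg_of_nonpos (by positivity : 0 ≤ p * ρ) hBpm]

lemma Balanced.exceptional_of_weight_eq_zero (h : Balanced A B m n ρ p 0) (hB : 0 < B)
    (hm : |m| < A) (hρ : 1 ≤ ρ) (hp : 0 < p) : (m = 0 ∧ ρ = 1) ∨ Exceptional A m ρ p := by
  rw [abs_lt] at hm
  have hrest (f : ℝ → ℝ) (hf : f.Odd) :
      p * ρ * f (B + m) = (ρ ^ 2 - 1) * f (A - B) + p * f (B - m) := by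
    linarith [h f hf]
  rcases (h.middle_nonneg hB hm.2 hρ hp).eq_or_lt with rfl | hm0
  · refine hρ.eq_or_lt.imp (fun h => ⟨rfl, h.symm⟩) fun hρ => .inr ⟨rfl, ?_⟩
    have htest := hrest _ (odd_oddIndicator B)
    rw [sub_zero, add_zero, oddIndicator_self hB.ne'] at htest
    have hAB : A - B = B := by
      by_contra hne
      rw [oddIndicator_eq_zero hne (by grind)] at htest
      have : p * (ρ - 1) = 0 := by linarith
      exact (mul_pos hp (sub_pos.2 hρ)).ne' this
    rw [hAB, oddIndicator_self hB.ne'] at htest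
    refine ⟨3 * B, B, _, hB, hρ, rfl, .inl ⟨rfl, by linarith, ?_⟩⟩
    exact mul_right_cancel₀ (sub_ne_zero.2 hρ.ne') (by linarith)
  · have htest := hrest _ (odd_oddIndicator (B + m))
    rw [oddIndicator_self (by grind), oddIndicator_eq_zero (y := B - m) (by grind) (by grind)]
      at htest
    have hAB : A - B = B + m := by
      by_contra hne
      rw [oddIndicator_eq_zero hne (by grind)] at htest
      linarith [mul_pos hp (one_pos.trans_le hρ)]
    rw [hAB, oddIndicator_self (by grind)] at htest
    have hBm : B - m = 0 := by
      by_contra hne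
      have htest' := hrest _ (odd_oddIndicator (B - m))
      rw [hAB, oddIndicator_self hne, oddIndicator_eq_zero (by grind) (by grind)] at htest'
      linarith
    refine .inr (.inl ⟨2 * m, ρ + 1, hm0, ?_, ?_, .inl ⟨by linarith, rfl, rfl⟩⟩)
    · nlinarith
    · field_simp
      linarith

lemma Balanced.exceptional_of_ne (h : Balanced A B m n ρ p q) (hAB : A ≠ B) (hm : |m| < A)
    (hn : |n| < B) (hρ : 1 ≤ ρ) (hp : 0 < p) (hq : 0 < q) :
    (m = 0 ∧ ρ = 1) ∨ Exceptional A m ρ p := by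
  have hρ0 : 0 < ρ := by positivity
  rcases hAB.lt_or_gt with hlt | hlt
  · obtain rfl := h.swap.middle_eq_zero_of_lt hlt hn hm hρ0 hq.le hp
    refine hρ.eq_or_lt.imp (fun h => ⟨rfl, h.symm⟩) fun hρ => .inr ⟨rfl, B, n, q, ?_⟩
    exact h.swap.exceptionalPair_of_lt (by simpa using hm) hlt hn hρ hq hp
  · obtain rfl := h.middle_eq_zero_of_lt hlt hm hn hρ0 hp.le hq
    rcases hρ.eq_or_lt with rfl | hρ
    · exact .inl ⟨h.middle_eq_zero_of_eq_one hp hq.le, rfl⟩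
    · exact .inr (.inl ⟨B, q, h.exceptionalPair_of_lt (by simpa using hn) hlt hm hρ hp hq⟩)

theorem Balanced.eq_or_centered_or_exceptional (h : Balanced A B m n ρ p q) (hm : |m| < A)
    (hn : |n| < B) (hρ : 1 ≤ ρ) (hp : 0 < p) (hq : 0 ≤ q) :
    (A = B ∧ m = n ∧ p = q) ∨ (m = 0 ∧ ρ = 1) ∨ Exceptional A m ρ p := by
  rcases hq.eq_or_lt with rfl | hq
  · exact .inr (h.exceptional_of_weight_eq_zero ((abs_nonneg n).trans_lt hn) hm hρ hp)
  obtain rfl | hAB := eq_or_ne A B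
  · obtain ⟨rfl, rfl | hcentered⟩ := h.eq_or_centered hm hn (by positivity) hp hq
    · exact .inl ⟨rfl, rfl, rfl⟩
    · exact .inr (.inl hcentered)
  · exact .inr (h.exceptional_of_ne hAB hm hn hρ hp hq)

end Balanced

section Shape

variable {A B c d m n ρ p q r s : ℝ} {θ θ' : Param 3}

/-- The parameter `θ` has the locations `(s - A, s + m, s + A)` and weights proportional to
`(ρ, p, 1)`. Every three-point parameter with positive end weights is of this form; `s` is the
midpoint of its extreme locations. -/
def HasShape (s A m ρ p : ℝ) (θ : Param 3) : Prop :=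
  θ.2 = ![s - A, s + m, s + A] ∧ Proportional θ.1 ![ρ, p, 1]

lemma mem_Omega_three_iff :
    θ ∈ Omega 3 ↔ (0 ≤ θ.1 0 ∧ 0 ≤ θ.1 1 ∧ 0 ≤ θ.1 2) ∧ θ.1 0 + θ.1 1 + θ.1 2 = 1 ∧
      θ.2 0 < θ.2 1 ∧ θ.2 1 < θ.2 2 := by
  simp [Omega, Fin.forall_fin_succ, Fin.sum_univ_three, Fin.strictMono_iff_lt_succ]

lemma HasShape.abs_lt (h : HasShape s A m ρ p θ) (hθ : θ ∈ Omega 3) : |m| < A := by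
  obtain ⟨-, -, h01, h12⟩ := mem_Omega_three_iff.1 hθ
  simp only [h.1, Matrix.cons_val] at h01 h12
  exact _root_.abs_lt.2 ⟨by linarith, by linarith⟩

lemma HasShape.end_weights_pos (h : HasShape s A m ρ p θ) (hρ : 0 < ρ) :
    0 < θ.1 0 ∧ 0 < θ.1 2 := by
  obtain ⟨-, a, ha, hw⟩ := h
  simpa [hw, ha] using hρ

lemma exists_hasShape (hzero : 0 < θ.1 0) (hlast : 0 < θ.1 2) :
    ∃ s A m, HasShape s A m (θ.1 0 / θ.1 2) (θ.1 1 / θ.1 2) θ := by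
  refine ⟨(θ.2 0 + θ.2 2) / 2, (θ.2 2 - θ.2 0) / 2, θ.2 1 - (θ.2 0 + θ.2 2) / 2, ?_,
    θ.1 2, hlast, ?_⟩ <;> ext i <;> fin_cases i
  all_goals simp
  all_goals field_simp
  all_goals ring

lemma exists_mem_Omega_hasShape (s : ℝ) (hm : |m| < A) (hρ : 0 ≤ ρ) (hp : 0 ≤ p) :
    ∃ θ ∈ Omega 3, HasShape s A m ρ p θ := by
  rw [_root_.abs_lt] at hm
  refine ⟨((ρ + p + 1)⁻¹ • ![ρ, p, 1], ![s - A, s + m, s + A]), mem_Omega_three_iff.2 ?_, rfl,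
    (ρ + p + 1)⁻¹, by positivity, rfl⟩
  simp only [Pi.smul_apply, smul_eq_mul, Matrix.cons_val]
  refine ⟨⟨by positivity, by positivity, by positivity⟩, ?_, by linarith, by linarith⟩
  field_simp

lemma HasShape.eq (h : HasShape s A m ρ p θ) (h' : HasShape s A m ρ p θ') (hθ : θ ∈ Omega 3)
    (hθ' : θ' ∈ Omega 3) : θ' = θ := by
  obtain ⟨hx, a, -, hw⟩ := h
  obtain ⟨hx', b, -, hw'⟩ := h'
  have hsum : a * ∑ j, ![ρ, p, 1] j = 1 := by
    simpa only [hw, Pi.smul_apply, smul_eq_mul, ← Finset.mul_sum] using hθ.2.1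
  have hsum' : b * ∑ j, ![ρ, p, 1] j = 1 := by
    simpa only [hw', Pi.smul_apply, smul_eq_mul, ← Finset.mul_sum] using hθ'.2.1
  refine Prod.ext ?_ (hx'.trans hx.symm)
  rw [hw, hw', mul_right_cancel₀ (right_ne_zero_of_mul_eq_one hsum) (hsum.trans hsum'.symm)]

lemma HasShape.companion_iff (h : HasShape s A m ρ p θ) (h' : HasShape s B n ρ q θ')
    (hθ : θ ∈ Omega 3) (hθ' : θ' ∈ Omega 3) :
    Companion (Delta θ) (Delta θ') ↔ Balanced A B m n ρ p q := by
  obtain ⟨hx, a, ha, hw⟩ := h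
  obtain ⟨hx', b, hb, hw'⟩ := h'
  rw [companion_Delta_iff hθ hθ']
  refine forall₂_congr fun f hf => ?_
  have hsum : ∑ i, ∑ j, θ.1 i * θ'.1 j * f (θ.2 i - θ'.2 j) =
      a * b * (q * f (A - n) + p * ρ * f (B + m) + p * q * f (m - n) -
        ((ρ ^ 2 - 1) * f (A - B) + q * ρ * f (A + n) + p * f (B - m))) := by
    simp only [hx, hx', hw, hw', Fin.sum_univ_three, Pi.smul_apply, smul_eq_mul, Matrix.cons_val]
    rw [show s - A - (s - B) = -(A - B) by ring, show s - A - (s + n) = -(A + n) by ring,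
      show s - A - (s + B) = -(A + B) by ring, show s + m - (s - B) = B + m by ring,
      show s + m - (s + n) = m - n by ring, show s + m - (s + B) = -(B - m) by ring,
      show s + A - (s - B) = A + B by ring, show s + A - (s + n) = A - n by ring,
      show s + A - (s + B) = A - B by ring, hf, hf, hf, hf]
    ring
  rw [hsum, mul_eq_zero_iff_left (mul_pos ha hb).ne', sub_eq_zero]

lemma Companion.hasShape_eq (h : Companion (Delta θ) (Delta θ')) (hθ : θ ∈ Omega 3)
    (hθ' : θ' ∈ Omega 3) {s' ρ' : ℝ} (hs : HasShape s A m ρ p θ) (hs' : HasShape s' B n ρ' q θ')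
    (hρ : 0 < ρ) (hρ' : 0 < ρ') : s' = s ∧ ρ' = ρ := by
  obtain ⟨hzero, hlast⟩ := hs.end_weights_pos hρ
  obtain ⟨hzero', hlast'⟩ := hs'.end_weights_pos hρ'
  obtain ⟨hx, a, ha, hw⟩ := hs
  obtain ⟨hx', b, hb, hw'⟩ := hs'
  have hends : θ.2 0 + θ.2 2 = θ'.2 0 + θ'.2 2 :=
    h.zero_add_last_eq hθ hθ' hzero hlast hzero' hlast'
  have hratio : θ.1 2 * θ'.1 0 = θ.1 0 * θ'.1 2 := h.last_mul_zero_eq hθ hθ' hends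
  simp only [hx, hx', Matrix.cons_val] at hends
  simp only [hw, hw', Pi.smul_apply, smul_eq_mul, Matrix.cons_val] at hratio
  exact ⟨by linarith, mul_left_cancel₀ (mul_pos ha hb).ne' (by linarith)⟩

lemma proportional_smul_iff {v w : Fin 3 → ℝ} (hr : 0 < r) :
    Proportional v (r • w) ↔ Proportional v w := by
  constructor
  · rintro ⟨a, ha, h⟩
    exact ⟨a * r, mul_pos ha hr, by rw [h, smul_smul]⟩
  · rintro ⟨a, ha, h⟩
    exact ⟨a / r, div_pos ha hr, by rw [h, smul_smul, div_mul_cancel₀ _ hr.ne']⟩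

lemma caseOne_iff (hr : 0 < r) :
    CaseOne c d r θ ↔ HasShape (c + 3 * d) (3 * d) d r ((r - 1) * (r + 1) / r) θ := by
  have hw : ![r ^ 2, r ^ 2 - 1, r] = r • ![r, (r - 1) * (r + 1) / r, 1] := by
    simp
    field_simp
    ring_nf
    simp
  rw [CaseOne, HasShape, hw, proportional_smul_iff hr]
  ring_nf

lemma caseOne'_iff : CaseOne' c d r θ ↔ HasShape (c + 3 * d) (2 * d) 0 r (r + 1) θ := by
  rw [CaseOne', HasShape]
  ring_nf

lemma caseTwo_iff (hr : 0 < r) :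
    CaseTwo c d r θ ↔ HasShape (c + 2 * d) (2 * d) d r ((r - 1) * √(r + r ^ 2) / r) θ := by
  have hsqrt : √(r + r ^ 2) = √r * √(r + 1) := by
    rw [← Real.sqrt_mul hr.le]
    ring_nf
  have hsq : √r * √r = r := Real.mul_self_sqrt hr.le
  have hw : ![r * √r, (r - 1) * √(r + 1), √r] =
      √r • ![r, (r - 1) * √(r + r ^ 2) / r, 1] := by
    have hmiddle : √r * ((r - 1) * √(r + r ^ 2) / r) = (r - 1) * √(r + 1) := by
      rw [hsqrt, mul_div_assoc', div_eq_iff hr.ne']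
      linear_combination (r - 1) * √(r + 1) * hsq
    simp [hmiddle, mul_comm]
  rw [CaseTwo, HasShape, hw, proportional_smul_iff (Real.sqrt_pos.2 hr)]
  ring_nf

lemma caseTwo'_iff : CaseTwo' c d r θ ↔ HasShape (c + 2 * d) d 0 r √(r + r ^ 2) θ := by
  rw [CaseTwo', HasShape]
  ring_nf

lemma mem_setA_iff :
    θ ∈ setA ↔ θ ∈ Omega 3 ∧ ∃ s A m ρ p, HasShape s A m ρ p θ ∧ Exceptional A m ρ p := by
  refine and_congr_right fun _ => ⟨?_, ?_⟩
  · rintro ⟨c, d, r, hd, hr, h | h | h | h⟩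
    · exact ⟨_, _, _, _, _, (caseOne_iff (by linarith)).1 h,
        .inl ⟨_, _, hd, hr, rfl, .inl ⟨rfl, rfl, rfl⟩⟩⟩
    · exact ⟨_, _, _, _, _, caseOne'_iff.1 h,
        .inr ⟨rfl, _, _, _, hd, hr, rfl, .inl ⟨rfl, rfl, rfl⟩⟩⟩
    · exact ⟨_, _, _, _, _, (caseTwo_iff (by linarith)).1 h,
        .inl ⟨_, _, hd, hr, rfl, .inr ⟨rfl, rfl, rfl⟩⟩⟩
    · exact ⟨_, _, _, _, _, caseTwo'_iff.1 h,
        .inr ⟨rfl, _, _, _, hd, hr, rfl, .inr ⟨rfl, rfl, rfl⟩⟩⟩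
  · rintro ⟨s, A, m, ρ, p, h, ⟨B, q, hm, hρ, rfl, ⟨rfl, rfl, rfl⟩ | ⟨rfl, rfl, rfl⟩⟩ |
      ⟨rfl, B, n, q, hn, hρ, -, ⟨-, rfl, rfl⟩ | ⟨-, rfl, rfl⟩⟩⟩
    · exact ⟨s - 3 * m, m, ρ, hm, hρ, .inl ((caseOne_iff (by linarith)).2 (by simpa using h))⟩
    · exact ⟨s - 2 * B, B, ρ, hm, hρ,
        .inr (.inr (.inl ((caseTwo_iff (by linarith)).2 (by simpa using h))))⟩
    · exact ⟨s - 3 * n, n, ρ, hn, hρ, .inr (.inl (caseOne'_iff.2 (by simpa using h)))⟩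
    · exact ⟨s - 2 * A, A, ρ, hn, hρ, .inr (.inr (.inr (caseTwo'_iff.2 (by simpa using h))))⟩

end Shape

section Degenerate

variable {k : ℕ}

lemma eventually_strictMono_update {ι : Type*} [Finite ι] [Preorder ι] [DecidableEq ι]
    {x : ι → ℝ} (hx : StrictMono x) (j : ι) :
    ∀ᶠ y in 𝓝 (x j), StrictMono (Function.update x j y) := by
  have hopen : IsOpen {v : ι → ℝ | StrictMono v} := by
    simp only [StrictMono, ofPred_forall]
    exact isOpen_iInter_of_finite fun i => isOpen_iInter_of_finite fun i' =>
      isOpen_iInter_of_finite fun _ => isOpen_lt (continuous_apply i) (continuous_apply i')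
  refine (continuous_const.update j continuous_id).continuousAt.eventually (hopen.mem_nhds ?_)
  simpa using hx

lemma exists_ne_Delta_eq_of_weight_eq_zero {θ : Param k} (hθ : θ ∈ Omega k) {j : Fin k}
    (hj : θ.1 j = 0) : ∃ θ' ∈ Omega k, Delta θ' = Delta θ ∧ θ' ≠ θ := by
  obtain ⟨y, hmono, hy⟩ := (((eventually_strictMono_update hθ.2.2 j).filter_mono
    nhdsWithin_le_nhds).and (eventually_mem_nhdsWithin (s := {θ.2 j}ᶜ))).exists
  refine ⟨(θ.1, Function.update θ.2 j y), ⟨hθ.1, hθ.2.1, hmono⟩, ?_, fun heq => hy ?_⟩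
  · refine Finset.sum_congr rfl fun i _ => ?_
    obtain rfl | hij := eq_or_ne i j
    · simp [hj]
    · simp [Function.update_of_ne hij]
  · simpa using congrFun (congrArg Prod.snd heq) j

variable {θ : Param 3}

lemma exists_ne_companion_of_isSymmetric (hθ : θ ∈ Omega 3) (h : IsSymmetric (Delta θ)) :
    ∃ θ' ∈ Omega 3, Companion (Delta θ) (Delta θ') ∧ θ' ≠ θ := by
  have := isProbabilityMeasure_Delta hθ
  obtain ⟨s, hs⟩ := isSymmetric_iff_exists_companion_dirac.1 h
  set η : Param 3 := (![0, 1, 0], ![s - 1, s, s + 1])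
  have hη : η ∈ Omega 3 := by simp [mem_Omega_three_iff, η]
  have hdirac : Delta η = Measure.dirac s := by simp [Delta, Fin.sum_univ_three, η]
  rw [← hdirac] at hs
  obtain rfl | hne := eq_or_ne η θ
  · obtain ⟨θ', hθ', heq, hne⟩ := exists_ne_Delta_eq_of_weight_eq_zero (j := 0) hη rfl
    exact ⟨θ', hθ', heq ▸ hs, hne⟩
  · exact ⟨η, hη, hs, hne⟩

lemma exists_positive_ends_Delta_eq {a b x y : ℝ} (ha : 0 < a) (hb : 0 < b) (hab : a + b = 1)
    (hxy : x < y) :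
    ∃ θ ∈ Omega 3, 0 < θ.1 0 ∧ 0 < θ.1 2 ∧ θ.1 1 = 0 ∧
      Delta θ = ENNReal.ofReal a • Measure.dirac x + ENNReal.ofReal b • Measure.dirac y :=
  ⟨(![a, 0, b], ![x, (x + y) / 2, y]), mem_Omega_three_iff.2 ⟨⟨ha.le, le_rfl, hb.le⟩,
    by simpa using hab, left_lt_add_div_two.2 hxy, add_div_two_lt_right.2 hxy⟩, ha, hb, rfl,
    by simp [Delta, Fin.sum_univ_three]⟩

lemma Delta_eq_dirac_or_exists_positive_ends (hθ : θ ∈ Omega 3) :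
    (∃ s, Delta θ = Measure.dirac s) ∨ ∃ θ' ∈ Omega 3, 0 < θ'.1 0 ∧ 0 < θ'.1 2 ∧
      Delta θ' = Delta θ ∧ (θ' = θ ∨ θ'.1 1 = 0) := by
  obtain ⟨⟨h0, h1, h2⟩, hsum, hlt, hlt'⟩ := mem_Omega_three_iff.1 hθ
  have hΔ : Delta θ = ENNReal.ofReal (θ.1 0) • Measure.dirac (θ.2 0) +
      ENNReal.ofReal (θ.1 1) • Measure.dirac (θ.2 1) +
      ENNReal.ofReal (θ.1 2) • Measure.dirac (θ.2 2) := Fin.sum_univ_three _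
  rcases h0.eq_or_lt with h0 | h0 <;> rcases h2.eq_or_lt with h2 | h2
  · exact .inl ⟨θ.2 1, by simp [hΔ, ← h0, ← h2, show θ.1 1 = 1 by linarith]⟩
  · rcases h1.eq_or_lt with h1 | h1
    · exact .inl ⟨θ.2 2, by simp [hΔ, ← h0, ← h1, show θ.1 2 = 1 by linarith]⟩
    · obtain ⟨θ', hθ', hzero, hlast, hmiddle, heq⟩ :=
        exists_positive_ends_Delta_eq h1 h2 (by linarith) hlt'
      exact .inr ⟨θ', hθ', hzero, hlast, by simp [heq, hΔ, ← h0], .inr hmiddle⟩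
  · rcases h1.eq_or_lt with h1 | h1
    · exact .inl ⟨θ.2 0, by simp [hΔ, ← h1, ← h2, show θ.1 0 = 1 by linarith]⟩
    · obtain ⟨θ', hθ', hzero, hlast, hmiddle, heq⟩ :=
        exists_positive_ends_Delta_eq h0 h1 (by linarith) hlt
      exact .inr ⟨θ', hθ', hzero, hlast, by simp [heq, hΔ, ← h2], .inr hmiddle⟩
  · exact .inr ⟨θ, hθ, h0, h2, rfl, .inl rfl⟩

end Degenerate

section Classification

variable {A m ρ p s : ℝ} {θ θ' : Param 3}

/-- The parameter of the image of `Delta θ` under `x ↦ -x`, as it occurs in `setAneg`. -/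
def reflect (θ : Param 3) : Param 3 :=
  (![θ.1 2, θ.1 1, θ.1 0], ![-θ.2 2, -θ.2 1, -θ.2 0])

lemma reflect_mem_Omega (hθ : θ ∈ Omega 3) : reflect θ ∈ Omega 3 := by
  obtain ⟨⟨h0, h1, h2⟩, hsum, hlt, hlt'⟩ := mem_Omega_three_iff.1 hθ
  exact mem_Omega_three_iff.2 ⟨⟨h2, h1, h0⟩, by simp [reflect]; linarith, neg_lt_neg hlt',
    neg_lt_neg hlt⟩

lemma reflect_involutive : Function.Involutive reflect := fun θ => by
  ext i <;> fin_cases i <;> simp [reflect]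

lemma Delta_reflect (θ : Param 3) : Delta (reflect θ) = (Delta θ).map fun x => -x := by
  refine Eq.trans ?_ (map_neg_atoms θ.1 θ.2).symm
  simp only [Delta, atoms, reflect, Fin.sum_univ_three, Matrix.cons_val, Pi.neg_apply]
  abel

lemma Companion.reflect (hθ : θ ∈ Omega 3) (hθ' : θ' ∈ Omega 3)
    (h : Companion (Delta θ) (Delta θ')) :
    Companion (Delta (reflect θ)) (Delta (reflect θ')) := by
  have := isProbabilityMeasure_Delta hθ
  have := isProbabilityMeasure_Delta hθ'
  simpa only [Delta_reflect] using h.map_neg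

lemma HasShape.isSymmetric (h : HasShape s A 0 1 p θ) (hθ : θ ∈ Omega 3) :
    IsSymmetric (Delta θ) := by
  obtain ⟨hx, a, -, hw⟩ := h
  refine (isSymmetric_Delta_iff hθ).2 ⟨s, fun f hf => ?_⟩
  simp [hx, hw, Fin.sum_univ_three, hf.map_zero, hf A]

lemma Companion.eq_or_isSymmetric_or_mem_setA (h : Companion (Delta θ) (Delta θ'))
    (hθ : θ ∈ Omega 3) (hθ' : θ' ∈ Omega 3) (hpos : ∀ i, 0 < θ.1 i) (hle : θ.1 2 ≤ θ.1 0)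
    (hzero' : 0 < θ'.1 0) (hlast' : 0 < θ'.1 2) :
    θ' = θ ∨ IsSymmetric (Delta θ) ∨ θ ∈ setA := by
  obtain ⟨s, A, m, hs⟩ := exists_hasShape (hpos 0) (hpos 2)
  obtain ⟨s', B, n, hs'⟩ := exists_hasShape hzero' hlast'
  have hρ : 1 ≤ θ.1 0 / θ.1 2 := (one_le_div (hpos 2)).2 hle
  obtain ⟨rfl, hρ'⟩ := h.hasShape_eq hθ hθ' hs hs' (div_pos (hpos 0) (hpos 2))
    (div_pos hzero' hlast')
  rw [hρ'] at hs'
  rcases ((hs.companion_iff hs' hθ hθ').1 h).eq_or_centered_or_exceptional (hs.abs_lt hθ)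
    (hs'.abs_lt hθ') hρ (div_pos (hpos 1) (hpos 2)) (div_nonneg (hθ'.1 1) hlast'.le) with
    ⟨rfl, rfl, hp⟩ | ⟨rfl, hρ1⟩ | hexceptional
  · exact .inl ((hp ▸ hs).eq hs' hθ hθ')
  · exact .inr (.inl ((hρ1 ▸ hs).isSymmetric hθ))
  · exact .inr (.inr (mem_setA_iff.2 ⟨hθ, _, _, _, _, _, hs, hexceptional⟩))

lemma Companion.eq_or_isSymmetric_or_mem (h : Companion (Delta θ) (Delta θ'))
    (hθ : θ ∈ Omega 3) (hθ' : θ' ∈ Omega 3) (hpos : ∀ i, 0 < θ.1 i)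
    (hzero' : 0 < θ'.1 0) (hlast' : 0 < θ'.1 2) :
    θ' = θ ∨ IsSymmetric (Delta θ) ∨ θ ∈ setA ∪ setAneg := by
  have := isProbabilityMeasure_Delta hθ
  rcases le_total (θ.1 2) (θ.1 0) with hle | hle
  · exact (h.eq_or_isSymmetric_or_mem_setA hθ hθ' hpos hle hzero' hlast').imp_right
      (Or.imp_right .inl)
  · rcases (h.reflect hθ hθ').eq_or_isSymmetric_or_mem_setA (reflect_mem_Omega hθ)
      (reflect_mem_Omega hθ') (by simp [Fin.forall_fin_succ, SymMixture.reflect, hpos]) hle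
      hlast' hzero' with heq | hsymm | hmem
    · exact .inl (reflect_involutive.injective heq)
    · rw [← reflect_involutive θ, Delta_reflect]
      have := isProbabilityMeasure_Delta (reflect_mem_Omega hθ)
      exact .inr (.inl hsymm.map_neg)
    · exact .inr (.inr (.inr ⟨hθ, hmem⟩))

theorem Companion.eq_or_mem (h : Companion (Delta θ) (Delta θ')) (hθ : θ ∈ Omega 3)
    (hθ' : θ' ∈ Omega 3) (hpos : ∀ i, 0 < θ.1 i) :
    θ' = θ ∨ θ ∈ setA ∪ setAneg ∪ setB := by
  have := isProbabilityMeasure_Delta hθ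
  rcases Delta_eq_dirac_or_exists_positive_ends hθ' with
    ⟨s, hs⟩ | ⟨θ'', hθ'', hzero, hlast, heq, hθ''_eq⟩
  · exact .inr (.inr ⟨hθ, .inl (isSymmetric_iff_exists_companion_dirac.2 ⟨s, hs ▸ h⟩)⟩)
  · rw [← heq] at h
    rcases h.eq_or_isSymmetric_or_mem hθ hθ'' hpos hzero hlast with rfl | hsymm | hmem
    · exact .inl (hθ''_eq.resolve_right (hpos 1).ne').symm
    · exact .inr (.inr ⟨hθ, .inl hsymm⟩)
    · exact .inr (.inl hmem)

end Classification

section Companions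

variable {A B m n ρ p q s : ℝ} {θ : Param 3}

lemma HasShape.exists_ne_companion (hs : HasShape s A m ρ p θ) (hθ : θ ∈ Omega 3)
    (h : Balanced A B m n ρ p q) (hAB : A ≠ B) (hn : |n| < B) (hρ : 0 ≤ ρ) (hq : 0 ≤ q) :
    ∃ θ' ∈ Omega 3, Companion (Delta θ) (Delta θ') ∧ θ' ≠ θ := by
  obtain ⟨θ', hθ', hs'⟩ := exists_mem_Omega_hasShape s hn hρ hq
  refine ⟨θ', hθ', (hs.companion_iff hs' hθ hθ').2 h, ?_⟩
  rintro rfl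
  exact hAB (sub_right_inj.1 (congrFun (hs.1.symm.trans hs'.1) 0))

lemma ExceptionalPair.locations_lt (h : ExceptionalPair A m B ρ p q) :
    |m| < A ∧ 0 < B ∧ B < A := by
  obtain ⟨hm, -, -, ⟨rfl, rfl, -⟩ | ⟨rfl, rfl, -⟩⟩ := h <;> rw [abs_of_pos hm] <;>
    refine ⟨?_, ?_, ?_⟩ <;> linarith

lemma ExceptionalPair.weights_nonneg (h : ExceptionalPair A m B ρ p q) :
    0 ≤ ρ ∧ 0 ≤ p ∧ 0 ≤ q := by
  obtain ⟨-, hρ, rfl, hq⟩ := h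
  have : 0 ≤ ρ - 1 := by linarith
  have hq : 0 ≤ q := by
    obtain ⟨-, -, rfl⟩ | ⟨-, -, rfl⟩ := hq <;> positivity
  exact ⟨by positivity, by positivity, hq⟩

lemma exists_ne_companion_of_mem_setA (h : θ ∈ setA) :
    ∃ θ' ∈ Omega 3, Companion (Delta θ) (Delta θ') ∧ θ' ≠ θ := by
  obtain ⟨hθ, s, A, m, ρ, p, hs, ⟨B, q, hpair⟩ | ⟨rfl, B, n, q, hpair⟩⟩ := mem_setA_iff.1 h
  · obtain ⟨-, hB, hBA⟩ := hpair.locations_lt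
    obtain ⟨hρ, -, hq⟩ := hpair.weights_nonneg
    exact hs.exists_ne_companion hθ hpair.balanced hBA.ne' (by simpa using hB) hρ hq
  · obtain ⟨hn, -, hAB⟩ := hpair.locations_lt
    obtain ⟨hρ, hq, -⟩ := hpair.weights_nonneg
    exact hs.exists_ne_companion hθ hpair.balanced.swap hAB.ne hn hρ hq

lemma exists_ne_companion_of_mem_setAneg (h : θ ∈ setAneg) :
    ∃ θ' ∈ Omega 3, Companion (Delta θ) (Delta θ') ∧ θ' ≠ θ := by
  obtain ⟨θ', hθ', hc, hne⟩ := exists_ne_companion_of_mem_setA h.2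
  refine ⟨reflect θ', reflect_mem_Omega hθ', ?_, fun heq => hne ?_⟩
  · rw [← reflect_involutive θ]
    exact hc.reflect (reflect_mem_Omega h.1) hθ'
  · exact reflect_involutive.eq_iff.1 heq

lemma exists_ne_companion_of_mem (h : θ ∈ setA ∪ setAneg ∪ setB) :
    ∃ θ' ∈ Omega 3, Companion (Delta θ) (Delta θ') ∧ θ' ≠ θ := by
  rcases h with (hA | hA) | ⟨hθ, hsymm | hzero⟩
  · exact exists_ne_companion_of_mem_setA hA
  · exact exists_ne_companion_of_mem_setAneg hA
  · exact exists_ne_companion_of_isSymmetric hθ hsymm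
  · have := isProbabilityMeasure_Delta hθ
    obtain ⟨j, -, hj⟩ := Finset.prod_eq_zero_iff.1 ((Fin.prod_univ_three θ.1).trans hzero)
    obtain ⟨θ', hθ', heq, hne⟩ := exists_ne_Delta_eq_of_weight_eq_zero hθ hj
    exact ⟨θ', hθ', heq.symm ▸ Companion.refl _, hne⟩

lemma weight_pos_of_notMem_setB (hθ : θ ∈ Omega 3) (h : θ ∉ setB) (j : Fin 3) : 0 < θ.1 j := by
  refine (hθ.1 j).lt_of_ne fun hj => h ⟨hθ, .inr ?_⟩
  rw [← Fin.prod_univ_three]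
  exact Finset.prod_eq_zero (Finset.mem_univ j) hj.symm

end Companions

end SymMixture

theorem theoremA1 :
    SymMixture.OmegaStar 3 =
      SymMixture.Omega 3 \ (SymMixture.setA ∪ SymMixture.setAneg ∪ SymMixture.setB) := by
  open SymMixture in
  ext θ
  rw [mem_OmegaStar_iff, Set.mem_sdiff]
  refine and_congr_right fun hθ => ⟨fun huniq hmem => ?_, fun hmem θ' hθ' hc => ?_⟩
  · obtain ⟨θ', hθ', hc, hne⟩ := exists_ne_companion_of_mem hmem
    exact hne (huniq θ' hθ' hc)
  · have hpos := weight_pos_of_notMem_setB hθ fun hB => hmem (.inr hB)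
    exact (hc.eq_or_mem hθ hθ' hpos).resolve_right hmem
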